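/- All rings are associative with identity, not necessarily commutative; matrices have entries in the ring, and $(B,A)$ denotes $B$ followed by the columns of $A$. Let $R$ be a ring. For $n\ge 0$ let $L'_n(R)$ be the set of pairs $(B\,|\,A)$ of matrices over $R$ with the same number of rows, where $A$ has $n$ columns. Put $(B\,|\,A)\le_n(B'\,|\,A')$ if there are matrices $U,V,G$ over $R$ of appropriate sizes with $UB=B'V$ and $UA=A'+B'G$. This is a pre-order; let $L_n(R)$ be the partially ordered set of its equivalence classes $[B\,|\,A]$, and $0_n=[0\,|\,I_n]$ its minimum element. The Goursat group $G(R)$ is the free abelian group on $\bigcup_{n\ge 1}L_n(R)$ modulo the relations (1) $[B,A\,|\,A']-[B\,|\,A']=[B,A'\,|\,A]-[B\,|\,A]$ for all matrices $A,A',B$ with the same number of rows ($A$ and $A'$ having at least one column); (2) $\left[\begin{array}{cc|cc}B&0&A&0\\0&B'&0&A'\end{array}\right]=[B\,|\,A]+[B'\,|\,A']$ for $[B\,|\,A]\in L_m(R)$, $[B'\,|\,A']\in L_n(R)$, $m,n\ge 1$; (3) $0_n=0$ for all $n\ge 1$. The group $G_0(R)$ is the free abelian group on $L_1(R)$ modulo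 the relations (1) for column matrices $A,A'$, and $0_1=0$. The group $K_0(R\text{-mod},\oplus)$ is the free abelian group on symbols $\{M\}$, for $M$ a finitely presented left $R$-module (depending only on the isomorphism class of $M$), modulo the relations $\{M\oplus N\}=\{M\}+\{N\}$. For an $m\times n$ matrix $A$ write $\{A\}=\{M_A\}$, where $M_A$ is the cokernel of the map $R^m\to R^n$, $x\mapsto xA$, of left modules of row vectors. Theorem. For every ring $R$ there are morphisms of abelian groups $$\iota_R:G_0(R)\to G(R),\qquad \gamma_R:G(R)\to K_0(R\text{-mod},\oplus),\qquad \kappa_R:K_0(R\text{-mod},\oplus)\to G_0(R)$$ whose values on generators are $$\iota_R[B\,|\,A]=[B\,|\,A],\qquad \gamma_R[B\,|\,A]=\{B,A\}-\{B\},\qquad \kappa_R\{A\}=\sum_{i=1}^n[A_1,\dots,A_{i-1}\,|\,A_i]$$ for $A=(A_1,\dots,A_n)$ in the last formula. All three are isomorphisms, and going once around the triangle is the identity from each vertex: $\kappa_R\gamma_R\iota_R=1_{G_0(R)}$, $\iota_R\kappa_R\gamma_R=1_{G(R)}$ and $\gamma_R\iota_R\kappa_R=1_{K_0(R\text{-mod},\oplus)}$.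 Moreover $\iota,\gamma,\kappa$ are natural in $R$: every ring morphism $f:R\to S$ induces morphisms $G_0(f)$, $G(f)$, $K_0(f)$ of abelian groups, given on generators by $[B\,|\,A]\mapsto[f(B)\,|\,f(A)]$ for $G_0(f)$ and $G(f)$ and by $\{A\}\mapsto\{f(A)\}$ for $K_0(f)$, and these commute with $\iota$, $\gamma$ and $\kappa$. -/

import Mathlib

universe u

namespace MatrixCalculus

section Matrices

variable {R : Type u} [Ring R]

/-- The matrix `(B, A)` obtained by writing `A` to the right of `B`. -/
def hcat {m k n : ℕ} (B : Matrix (Fin m) (Fin k) R) (A : Matrix (Fin m) (Fin n) R) :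
    Matrix (Fin m) (Fin (k + n)) R :=
  Matrix.reindex (Equiv.refl (Fin m)) finSumFinEquiv (Matrix.fromCols B A)

/-- The block diagonal matrix with diagonal blocks `A` and `B`. -/
def blockDiag {m n m' n' : ℕ} (A : Matrix (Fin m) (Fin n) R) (B : Matrix (Fin m') (Fin n') R) :
    Matrix (Fin (m + m')) (Fin (n + n')) R :=
  Matrix.reindex finSumFinEquiv finSumFinEquiv (Matrix.fromBlocks A 0 0 B)

/-- The matrix consisting of the columns of `A` strictly to the left of the column `i`. -/
def colsBefore {m n : ℕ} (A : Matrix (Fin m) (Fin n) R) (i : Fin n) :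
    Matrix (Fin m) (Fin (i : ℕ)) R :=
  A.submatrix id (Fin.castLE i.is_lt.le)

/-- The column `i` of `A`, as a matrix with one column. -/
def column {m n : ℕ} (A : Matrix (Fin m) (Fin n) R) (i : Fin n) : Matrix (Fin m) (Fin 1) R :=
  A.submatrix id (fun _ => i)

end Matrices

/-- A representative `(B | A)` of an `n`-ary matrix pair: `A` has `n` columns and `B` has as many
rows as `A`. Here `left` is `B` and `right` is `A`. -/
structure PrePair (R : Type u) (n : ℕ) where
  rows : ℕ
  cols : ℕ
  left : Matrix (Fin rows) (Fin cols) R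
  right : Matrix (Fin rows) (Fin n) R

/-- `(B | A) ≤ (B' | A')` if there are `U`, `V`, `G` with `U B = B' V` and `U A = A' + B' G`. -/
instance (R : Type u) [Ring R] (n : ℕ) : Preorder (PrePair R n) where
  le p q := ∃ (U : Matrix (Fin q.rows) (Fin p.rows) R) (V : Matrix (Fin q.cols) (Fin p.cols) R)
    (G : Matrix (Fin q.cols) (Fin n) R),
    U * p.left = q.left * V ∧ U * p.right = q.right + q.left * G
  le_refl p := ⟨1, 1, 0, by simp, by simp⟩
  le_trans p q r := by
    rintro ⟨U, V, G, h, h'⟩ ⟨U', V', G', k, k'⟩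
    refine ⟨U' * U, V' * V, G' + V' * G, ?_, ?_⟩
    · rw [Matrix.mul_assoc, h, ← Matrix.mul_assoc, k, Matrix.mul_assoc]
    · rw [Matrix.mul_assoc, h', Matrix.mul_add, k', ← Matrix.mul_assoc, k, Matrix.mul_add,
        Matrix.mul_assoc, add_assoc]

/-- The partially ordered set of `n`-ary matrix pairs: classes of representatives modulo
`p ≤ q` and `q ≤ p`. -/
abbrev MatrixPair (R : Type u) [Ring R] (n : ℕ) : Type u :=
  Antisymmetrization (PrePair R n) (· ≤ ·)

/-- The matrix pair `[B | A]`. -/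
def pair {R : Type u} [Ring R] {m k n : ℕ} (B : Matrix (Fin m) (Fin k) R)
    (A : Matrix (Fin m) (Fin n) R) : MatrixPair R n :=
  toAntisymmetrization (· ≤ ·) ⟨m, k, B, A⟩

/-- The minimum element is `[0 | I]`, with `0` the zero column of height `n`. -/
instance (R : Type u) [Ring R] (n : ℕ) : OrderBot (MatrixPair R n) where
  bot := pair (0 : Matrix (Fin n) (Fin 1) R) (1 : Matrix (Fin n) (Fin n) R)
  bot_le a := by
    induction a using Quotient.inductionOn'
    rename_i p
    exact (toAntisymmetrization_le_toAntisymmetrization_iff).2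
      ⟨p.right, 0, 0, by simp, by simp⟩

section Goursat

variable (R : Type u) [Ring R]

/-- The relators of the zero-dimensional Goursat group. -/
inductive GoursatRelZero : FreeAbelianGroup (MatrixPair R 1) → Prop
  | exchange {m k : ℕ} (A A' : Matrix (Fin m) (Fin 1) R) (B : Matrix (Fin m) (Fin k) R) :
      GoursatRelZero
        ((FreeAbelianGroup.of (pair (hcat B A) A') - FreeAbelianGroup.of (pair B A')) -
          (FreeAbelianGroup.of (pair (hcat B A') A) - FreeAbelianGroup.of (pair B A)))
  | bot : GoursatRelZero (FreeAbelianGroup.of ⊥)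

/-- The zero-dimensional Goursat group `G₀(R)`. -/
abbrev GoursatGroupZero : Type u :=
  FreeAbelianGroup (MatrixPair R 1) ⧸ AddSubgroup.closure {x | GoursatRelZero R x}

/-- The set of all matrix pairs of positive arity. -/
abbrev AnyPair : Type u := Σ n : {n : ℕ // 0 < n}, MatrixPair R n.1

variable {R} in
/-- An `n`-ary matrix pair, with `n` positive, as a generator of a free abelian group. -/
def gen {n : ℕ} (hn : 0 < n) (p : MatrixPair R n) : FreeAbelianGroup (AnyPair R) :=
  FreeAbelianGroup.of ⟨⟨n, hn⟩, p⟩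

/-- The relators of the Goursat group. -/
inductive GoursatRel : FreeAbelianGroup (AnyPair R) → Prop
  | exchange {m k n n' : ℕ} (hn : 0 < n) (hn' : 0 < n') (A : Matrix (Fin m) (Fin n) R)
      (A' : Matrix (Fin m) (Fin n') R) (B : Matrix (Fin m) (Fin k) R) :
      GoursatRel
        ((gen hn' (pair (hcat B A) A') - gen hn' (pair B A')) -
          (gen hn (pair (hcat B A') A) - gen hn (pair B A)))
  | sum {m k n m' k' n' : ℕ} (hn : 0 < n) (hn' : 0 < n') (B : Matrix (Fin m) (Fin k) R)
      (A : Matrix (Fin m) (Fin n) R) (B' : Matrix (Fin m') (Fin k') R)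
      (A' : Matrix (Fin m') (Fin n') R) :
      GoursatRel
        (gen (Nat.add_pos_left hn n') (pair (blockDiag B B') (blockDiag A A')) -
          (gen hn (pair B A) + gen hn' (pair B' A')))
  | bot {n : ℕ} (hn : 0 < n) : GoursatRel (gen hn ⊥)

/-- The Goursat group `G(R)`. -/
abbrev GoursatGroup : Type u :=
  FreeAbelianGroup (AnyPair R) ⧸ AddSubgroup.closure {x | GoursatRel R x}

variable {R}

/-- The class of `[B | A]` in `G₀(R)`, for a column `A`. -/
def GoursatGroupZero.mk {m k : ℕ} (B : Matrix (Fin m) (Fin k) R) (A : Matrix (Fin m) (Fin 1) R) :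
    GoursatGroupZero R :=
  QuotientAddGroup.mk (FreeAbelianGroup.of (pair B A))

/-- The class of `[B | A]` in `G(R)`. -/
def GoursatGroup.mk {m k n : ℕ} (hn : 0 < n) (B : Matrix (Fin m) (Fin k) R)
    (A : Matrix (Fin m) (Fin n) R) : GoursatGroup R :=
  QuotientAddGroup.mk (gen hn (pair B A))

end Goursat

section Grothendieck

variable (R : Type u) [Ring R]

/-- The finitely presented left `R`-modules. -/
abbrev FPModule : Type (u + 1) := {M : ModuleCat.{u} R // Module.FinitePresentation R M}

/-- The relators `{P} - ({M} + {N})` for `P` isomorphic to `M ⊕ N`. In particular isomorphic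
modules have the same class in the quotient, since the zero module is finitely presented. -/
inductive SplitRel : FreeAbelianGroup (FPModule R) → Prop
  | sum (M N P : FPModule R) (e : P.1 ≃ₗ[R] M.1 × N.1) :
      SplitRel (FreeAbelianGroup.of P - (FreeAbelianGroup.of M + FreeAbelianGroup.of N))

/-- The Grothendieck group `K₀(R-mod, ⊕)` of finitely presented left `R`-modules with respect to
direct sums. -/
abbrev SplitK0 : Type (u + 1) :=
  FreeAbelianGroup (FPModule R) ⧸ AddSubgroup.closure {x | SplitRel R x}

variable {R}

/-- The left `R`-module presented by an `m × n` matrix `A`: the cokernel of the map from `R ^ m`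
to `R ^ n` given by multiplication of row vectors on the right by `A`. -/
abbrev Presented {m n : ℕ} (A : Matrix (Fin m) (Fin n) R) : Type u :=
  (Fin n → R) ⧸ LinearMap.range A.vecMulLinear

theorem finitePresentation_presented {m n : ℕ} (A : Matrix (Fin m) (Fin n) R) :
    Module.FinitePresentation R (Presented A) := by
  refine Module.finitePresentation_of_surjective (Submodule.mkQ _)
    (Submodule.mkQ_surjective _) ?_
  rw [Submodule.ker_mkQ, LinearMap.range_eq_map]
  exact Module.Finite.fg_top.map _

/-- The class `{A}` in `K₀(R-mod, ⊕)` of the module presented by the matrix `A`. -/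
def SplitK0.ofMatrix {m n : ℕ} (A : Matrix (Fin m) (Fin n) R) : SplitK0 R :=
  QuotientAddGroup.mk
    (FreeAbelianGroup.of ⟨ModuleCat.of R (Presented A), finitePresentation_presented A⟩)

end Grothendieck

end MatrixCalculus

/-!
Matrix pairs are pointed modules. The pair `[B | A]` corresponds to the left module `M` presented by
`(B, A)` together with the tuple `x` of generators belonging to the columns of `A`, and the order on
pairs reverses the existence of linear maps that carry one tuple to the other (`prePair_le_iff`).
Conversely, every tuple in a finitely presented module comes from a matrix pair, so that `[M, x]`
makes sense (`pointedPair`). The pair `[B | A']` is `[M / (x), x']` when `[B, A | A']` is `[M, x']`,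
and the exchange relation reads `[M, x] + [M / (x), x'] = [M, x'] + [M / (x'), x]`.

* The map `γ` is `[M, x] ↦ {M} - {M / (x)}`. It is well defined because modules `M`, `M'` with maps
  in both directions that match `x` and `x'` satisfy `M ⊕ M' / (x') ≃ M' ⊕ M / (x)`
  (`nonempty_prod_quotient_equiv`).
* The map `κ` sends `{M}` to the sum of the classes obtained by killing the members of a generating
  tuple one at a time (`successiveSum`). Adding an element to a generating tuple does not change the
  sum, by repeated exchange (`zeroClass_add_successiveSum`), so the sum depends on `M` only; it is
  additive because killing elements of one summand leaves the other one a retract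
  (`successiveSum_add`).
* In `G(R)`, exchanging `x` with a generating tuple `w` gives `[M, x] = [M, w] - [M / (x), w]`
  (`tupleClass_add_of_span_eq_top`), since all entries of `x` vanish in `M / (w) = 0`.

With these descriptions the three round trips are telescoping sums. Bijectivity is formal, and so is
naturality once `K₀(f)` is defined by transporting `G₀(f)` along the triangle.
-/

namespace MatrixCalculus

open Matrix Submodule

/-! ### Presentations of modules by matrices -/

section Presentations

variable {R : Type u} [Ring R] {M M' : Type u} [AddCommGroup M] [Module R M]
  [AddCommGroup M'] [Module R M'] {ι ι' κ κ' : Type*} [Fintype ι] [Fintype ι'] [Fintype κ]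
  [Fintype κ']

/-- The family `y` generates `M`, and the rows of `A` generate the relations between its members.
The index types are arbitrary, so that columns can be regrouped freely. -/
structure IsPresentation (A : Matrix ι κ R) (y : κ → M) : Prop where
  span_eq_top : span R (Set.range y) = ⊤
  sum_eq_zero_iff : ∀ r : κ → R, ∑ j, r j • y j = 0 ↔ ∃ s : ι → R, s ᵥ* A = r

theorem sum_vecMul_smul (r : ι → R) (P : Matrix ι κ R) (y : κ → M) :
    ∑ l, (r ᵥ* P) l • y l = ∑ j, r j • ∑ l, P j l • y l := by
  simp only [Matrix.vecMul, dotProduct, Finset.sum_smul, Finset.smul_sum, smul_smul]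
  exact Finset.sum_comm

theorem exists_sum_of_span_eq_top {y : κ → M} (h : span R (Set.range y) = ⊤) (x : M) :
    ∃ r : κ → R, ∑ j, r j • y j = x :=
  (mem_span_range_iff_exists_fun R).1 (h ▸ mem_top)

namespace IsPresentation

theorem exists_lift {A : Matrix ι κ R} {y : κ → M} (hy : IsPresentation A y) (z : κ → M')
    (hz : ∀ i, ∑ j, A i j • z j = 0) : ∃ f : M →ₗ[R] M', ∀ j, f (y j) = z j := by
  classical
  have hs : Function.Surjective (Fintype.linearCombination R y) :=
    (span_range_eq_top_iff_surjective_fintypeLinearCombination ..).1 hy.span_eq_top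
  let e := (Fintype.linearCombination R y).quotKerEquivOfSurjective hs
  have hk : LinearMap.ker (Fintype.linearCombination R y) ≤
      LinearMap.ker (Fintype.linearCombination R z) := by
    intro r hr
    obtain ⟨s, rfl⟩ := (hy.sum_eq_zero_iff r).1 hr
    rw [LinearMap.mem_ker, Fintype.linearCombination_apply, sum_vecMul_smul]
    simp [hz]
  refine ⟨(liftQ _ _ hk).comp e.symm.toLinearMap, fun j => ?_⟩
  have : e.symm (y j) = Submodule.Quotient.mk (Pi.single j 1) := by
    rw [LinearEquiv.symm_apply_eq]
    simp [e, LinearMap.quotKerEquivOfSurjective]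
  simp [this]

/-- A matrix `P` describes a linear map on generators exactly when it carries the relations of the
source to relations of the target. -/
theorem exists_linearMap_iff {A : Matrix ι κ R} {y : κ → M} (hy : IsPresentation A y)
    {A' : Matrix ι' κ' R} {y' : κ' → M'} (hy' : IsPresentation A' y') (P : Matrix κ' κ R) :
    (∃ f : M' →ₗ[R] M, ∀ j, f (y' j) = ∑ l, P j l • y l) ↔
      ∃ U : Matrix ι' ι R, A' * P = U * A := by
  classical
  constructor
  · rintro ⟨f, hf⟩
    have h : ∀ i, ∃ s : ι → R, s ᵥ* A = (A' * P) i := by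
      intro i
      rw [← hy.sum_eq_zero_iff]
      have h0 : ∑ j, A' i j • y' j = 0 :=
        (hy'.sum_eq_zero_iff _).2 ⟨Pi.single i 1, by ext j; simp⟩
      have h1 := sum_vecMul_smul (A' i) P y
      simp only [← hf] at h1
      rw [show (A' * P) i = A' i ᵥ* P from rfl, h1]
      simpa using congrArg f h0
    choose U hU using h
    exact ⟨U, Matrix.ext fun i j => (congrFun (hU i) j).symm⟩
  · rintro ⟨U, hU⟩
    refine hy'.exists_lift _ fun i => ?_
    rw [← sum_vecMul_smul, show A' i ᵥ* P = U i ᵥ* A from congrFun hU i]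
    exact (hy.sum_eq_zero_iff _).2 ⟨_, rfl⟩

theorem submatrix {A : Matrix ι κ R} {y : κ → M} (hy : IsPresentation A y) (d : ι' ≃ ι)
    (e : κ' ≃ κ) : IsPresentation (A.submatrix d e) (y ∘ e) where
  span_eq_top := by rw [e.surjective.range_comp, hy.span_eq_top]
  sum_eq_zero_iff r := by
    have := hy.sum_eq_zero_iff (r ∘ e.symm)
    rw [← Equiv.sum_comp e] at this
    simp only [Function.comp_apply, Equiv.symm_apply_apply] at this ⊢
    rw [this]
    constructor
    · rintro ⟨s, hs⟩
      refine ⟨s ∘ d, ?_⟩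
      ext j
      have := congrFun hs (e j)
      simp only [Function.comp_apply, Equiv.symm_apply_apply] at this
      rw [← this]
      exact Equiv.sum_comp d (fun i => s i * A i (e j))
    · rintro ⟨s, hs⟩
      refine ⟨s ∘ d.symm, ?_⟩
      ext j
      rw [← hs]
      simp only [vecMul, dotProduct, Function.comp_apply, submatrix_apply, Equiv.apply_symm_apply]
      rw [← Equiv.sum_comp d]
      simp

/-- Deleting columns from a matrix divides the presented module by the corresponding generators. -/
theorem quotient {D : Matrix ι κ R} {E : Matrix ι κ' R} {y : κ → M} {x : κ' → M}
    (h : IsPresentation (fromCols D E) (Sum.elim y x)) {N : Submodule R M}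
    (hN : N = span R (Set.range x)) : IsPresentation D (N.mkQ ∘ y) where
  span_eq_top := by
    rw [eq_top_iff]
    rintro a -
    obtain ⟨b, rfl⟩ := N.mkQ_surjective a
    obtain ⟨r, rfl⟩ := exists_sum_of_span_eq_top h.span_eq_top b
    have hx : N.mkQ (∑ j, r (.inr j) • x j) = 0 := by
      rw [mkQ_apply, Submodule.Quotient.mk_eq_zero, hN]
      exact sum_mem fun j _ => smul_mem _ _ (subset_span ⟨j, rfl⟩)
    simp only [Fintype.sum_sum_type, Sum.elim_inl, Sum.elim_inr, map_add, hx, add_zero, map_sum,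
      map_smul]
    exact sum_mem fun j _ => smul_mem _ _ (subset_span ⟨j, rfl⟩)
  sum_eq_zero_iff r := by
    have h1 : ∑ j, r j • (N.mkQ ∘ y) j = N.mkQ (∑ j, r j • y j) := by simp
    rw [h1, mkQ_apply, Submodule.Quotient.mk_eq_zero, hN, mem_span_range_iff_exists_fun]
    constructor
    · rintro ⟨c, hc⟩
      obtain ⟨s, hs⟩ := (h.sum_eq_zero_iff (Sum.elim r (-c))).1 (by simp [hc])
      refine ⟨s, ?_⟩
      rw [vecMul_fromCols] at hs
      exact funext fun j => congrFun hs (.inl j)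
    · rintro ⟨s, rfl⟩
      have := (h.sum_eq_zero_iff (s ᵥ* fromCols D E)).2 ⟨s, rfl⟩
      rw [vecMul_fromCols] at this
      simp only [Fintype.sum_sum_type, Sum.elim_inl, Sum.elim_inr] at this
      exact ⟨-(s ᵥ* E), by simp [eq_neg_of_add_eq_zero_left this]⟩

theorem fromBlocks {A : Matrix ι κ R} {y : κ → M} (h : IsPresentation A y)
    {A' : Matrix ι' κ' R} {y' : κ' → M'} (h' : IsPresentation A' y') :
    IsPresentation (fromBlocks A 0 0 A')
      (Sum.elim (fun j => ((y j, 0) : M × M')) fun j => (0, y' j)) where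
  span_eq_top := by
    rw [eq_top_iff]
    rintro ⟨a, b⟩ -
    obtain ⟨r, rfl⟩ := exists_sum_of_span_eq_top h.span_eq_top a
    obtain ⟨r', rfl⟩ := exists_sum_of_span_eq_top h'.span_eq_top b
    refine (mem_span_range_iff_exists_fun R).2 ⟨Sum.elim r r', ?_⟩
    ext <;> simp [Prod.fst_sum, Prod.snd_sum]
  sum_eq_zero_iff r := by
    have h1 : ∑ j, r j • (Sum.elim (fun j => ((y j, 0) : M × M')) fun j => (0, y' j)) j =
        (∑ j, r (.inl j) • y j, ∑ j, r (.inr j) • y' j) := by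
      ext <;> simp [Prod.fst_sum, Prod.snd_sum]
    rw [h1, Prod.mk_eq_zero, h.sum_eq_zero_iff fun j => r (.inl j),
      h'.sum_eq_zero_iff fun j => r (.inr j)]
    constructor
    · rintro ⟨⟨s, hs⟩, ⟨s', hs'⟩⟩
      refine ⟨Sum.elim s s', ?_⟩
      rw [vecMul_fromBlocks]
      ext (j | j)
      · simpa using congrFun hs j
      · simpa using congrFun hs' j
    · rintro ⟨s, rfl⟩
      rw [vecMul_fromBlocks]
      exact ⟨⟨s ∘ Sum.inl, by simp⟩, ⟨s ∘ Sum.inr, by simp⟩⟩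

theorem nonempty_equiv {A : Matrix ι κ R} {y : κ → M} (h : IsPresentation A y) {y' : κ → M'}
    (h' : IsPresentation A y') : Nonempty (M ≃ₗ[R] M') := by
  classical
  have rel (N : Type u) [AddCommGroup N] [Module R N] {z : κ → N} (hz : IsPresentation A z) (i) :
      ∑ j, A i j • z j = 0 := (hz.sum_eq_zero_iff _).2 ⟨Pi.single i 1, by ext j; simp⟩
  obtain ⟨f, hf⟩ := h.exists_lift y' (rel _ h')
  obtain ⟨g, hg⟩ := h'.exists_lift y (rel _ h)
  refine ⟨LinearEquiv.ofLinearMap f g (LinearMap.ext_on_range h'.span_eq_top fun j => ?_)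
    (LinearMap.ext_on_range h.span_eq_top fun j => ?_)⟩ <;> simp [hf, hg]

end IsPresentation

theorem isPresentation_presented {m n : ℕ} (A : Matrix (Fin m) (Fin n) R) :
    IsPresentation A
      fun j => ((LinearMap.range A.vecMulLinear).mkQ (Pi.single j 1) : Presented A) := by
  have h (r : Fin n → R) : ∑ j, r j • (LinearMap.range A.vecMulLinear).mkQ (Pi.single j 1) =
      (LinearMap.range A.vecMulLinear).mkQ r := by
    simp only [← map_smul, ← map_sum]
    congr 1
    ext j
    simp [Finset.sum_apply, Pi.single_apply]
  constructor
  · rw [eq_top_iff]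
    rintro x -
    obtain ⟨r, rfl⟩ := mkQ_surjective _ x
    exact (mem_span_range_iff_exists_fun R).2 ⟨r, h r⟩
  · intro r
    rw [h, mkQ_apply, Submodule.Quotient.mk_eq_zero]
    rfl

/-- Any finite family in a finitely presented module can be completed to the generators of a finite
presentation. -/
theorem exists_isPresentation [Module.FinitePresentation R M] (x : ι → M) :
    ∃ (m k : ℕ) (C : Matrix (Fin m) (Fin k ⊕ ι) R) (y : Fin k → M),
      IsPresentation C (Sum.elim y x) := by
  obtain ⟨k, y, hy⟩ := Module.Finite.exists_fin (R := R) (M := M)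
  have hs : span R (Set.range (Sum.elim y x)) = ⊤ := by
    rw [eq_top_iff, ← hy, Set.Sum.elim_range]
    exact span_mono Set.subset_union_left
  have hsurj := (span_range_eq_top_iff_surjective_fintypeLinearCombination ..).1 hs
  obtain ⟨m, C, hC⟩ := fg_iff_exists_fin_generating_family.1
    (Module.FinitePresentation.fg_ker (Fintype.linearCombination R (Sum.elim y x)) hsurj)
  refine ⟨m, k, Matrix.of C, y, hs, fun r => ?_⟩
  rw [← Fintype.linearCombination_apply, ← LinearMap.mem_ker, ← hC, mem_span_range_iff_exists_fun]
  refine exists_congr fun s => ?_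
  rw [vecMul_eq_sum]
  rfl

end Presentations

/-! ### Matrix pairs as pointed modules -/

section PointedModules

variable {R : Type u} [Ring R] {M M' : Type u} [AddCommGroup M] [Module R M]
  [AddCommGroup M'] [Module R M']

/-- The order on matrix pairs, read off from the presented modules: it reverses the existence of
linear maps that preserve the distinguished tuples. -/
theorem prePair_le_iff {m k n m' k' : ℕ} {B : Matrix (Fin m) (Fin k) R}
    {A : Matrix (Fin m) (Fin n) R} {B' : Matrix (Fin m') (Fin k') R}
    {A' : Matrix (Fin m') (Fin n) R} {y : Fin k → M} {x : Fin n → M} {y' : Fin k' → M'}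
    {x' : Fin n → M'} (h : IsPresentation (fromCols B A) (Sum.elim y x))
    (h' : IsPresentation (fromCols B' A') (Sum.elim y' x')) :
    (⟨m, k, B, A⟩ : PrePair R n) ≤ ⟨m', k', B', A'⟩ ↔
      ∃ f : M' →ₗ[R] M, ∀ i, f (x' i) = x i := by
  -- A map fixing the tuples is described on generators by a block matrix `(V, G; 0, 1)`.
  have key (U : Matrix (Fin m') (Fin m) R) (V : Matrix (Fin k') (Fin k) R)
      (G : Matrix (Fin k') (Fin n) R) :
      fromCols B' A' * (fromBlocks V G 0 1 : Matrix (Fin k' ⊕ Fin n) (Fin k ⊕ Fin n) R) =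
        U * fromCols B A ↔ U * B = B' * V ∧ U * A = A' + B' * G := by
    rw [fromCols_mul_fromBlocks, mul_fromCols, Matrix.mul_zero, add_zero, Matrix.mul_one]
    constructor
    · intro h
      obtain ⟨h1, h2⟩ := fromCols_inj h
      exact ⟨h1.symm, by rw [add_comm, h2]⟩
    · rintro ⟨h1, h2⟩
      rw [h1, h2, add_comm]
  constructor
  · rintro ⟨U, V, G, hU⟩
    obtain ⟨f, hf⟩ := (h.exists_linearMap_iff h' _).2 ⟨U, (key U V G).2 hU⟩
    refine ⟨f, fun i => ?_⟩
    simpa [one_apply] using hf (.inr i)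
  · rintro ⟨f, hf⟩
    choose r hr using fun j => exists_sum_of_span_eq_top h.span_eq_top (f (y' j))
    let V : Matrix (Fin k') (Fin k) R := of fun j l => r j (.inl l)
    let G : Matrix (Fin k') (Fin n) R := of fun j l => r j (.inr l)
    obtain ⟨U, hU⟩ := (h.exists_linearMap_iff h' (fromBlocks V G 0 1)).1 ⟨f, by
      rintro (j | i)
      · simp [V, G, ← hr]
      · simp [hf, one_apply]⟩
    exact ⟨U, V, G, (key U V G).1 hU⟩

open Classical in
/-- The matrix pair `[B | A]` represented by the module `M` with the distinguished tuple `x`: any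
presentation of `M` in which the columns of `A` correspond to `x` gives the same class. If `M` is
not finitely presented, the value is `⊥`. -/
noncomputable def pointedPair {n : ℕ} (M : Type u) [AddCommGroup M] [Module R M] (x : Fin n → M) :
    MatrixPair R n :=
  if h : ∃ p : PrePair R n, ∃ y : Fin p.cols → M,
      IsPresentation (fromCols p.left p.right) (Sum.elim y x) then
    toAntisymmetrization (· ≤ ·) h.choose
  else ⊥

theorem pointedPair_eq_pair {m k n : ℕ} {B : Matrix (Fin m) (Fin k) R}
    {A : Matrix (Fin m) (Fin n) R} {y : Fin k → M} {x : Fin n → M}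
    (h : IsPresentation (fromCols B A) (Sum.elim y x)) : pointedPair M x = pair B A := by
  have hp : ∃ p : PrePair R n, ∃ y : Fin p.cols → M,
      IsPresentation (fromCols p.left p.right) (Sum.elim y x) := ⟨⟨m, k, B, A⟩, y, h⟩
  rw [pointedPair, dif_pos hp]
  obtain ⟨y', hy'⟩ := hp.choose_spec
  exact Quotient.sound' ⟨(prePair_le_iff hy' h).2 ⟨.id, fun _ => rfl⟩,
    (prePair_le_iff h hy').2 ⟨.id, fun _ => rfl⟩⟩

theorem exists_isPresentation_pair [Module.FinitePresentation R M] {n : ℕ} (x : Fin n → M) :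
    ∃ (m k : ℕ) (B : Matrix (Fin m) (Fin k) R) (A : Matrix (Fin m) (Fin n) R) (y : Fin k → M),
      IsPresentation (fromCols B A) (Sum.elim y x) := by
  obtain ⟨m, k, C, y, h⟩ := exists_isPresentation (R := R) x
  exact ⟨m, k, C.toCols₁, C.toCols₂, y, by rwa [fromCols_toCols]⟩

theorem pointedPair_congr [Module.FinitePresentation R M] [Module.FinitePresentation R M'] {n : ℕ}
    {x : Fin n → M} {x' : Fin n → M'} (f : M →ₗ[R] M') (g : M' →ₗ[R] M)
    (hf : ∀ i, f (x i) = x' i) (hg : ∀ i, g (x' i) = x i) :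
    (pointedPair M x : MatrixPair R n) = pointedPair M' x' := by
  obtain ⟨m, k, B, A, y, h⟩ := exists_isPresentation_pair (R := R) x
  obtain ⟨m', k', B', A', y', h'⟩ := exists_isPresentation_pair (R := R) x'
  rw [pointedPair_eq_pair h, pointedPair_eq_pair h']
  exact Quotient.sound' ⟨(prePair_le_iff h h').2 ⟨g, hg⟩, (prePair_le_iff h' h).2 ⟨f, hf⟩⟩

theorem isPresentation_hcat_iff {m k n : ℕ} {B : Matrix (Fin m) (Fin k) R}
    {A : Matrix (Fin m) (Fin n) R} {z : Fin k ⊕ Fin n → M} :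
    IsPresentation (hcat B A) (z ∘ finSumFinEquiv.symm) ↔ IsPresentation (fromCols B A) z := by
  constructor
  · intro h
    convert h.submatrix (Equiv.refl _) finSumFinEquiv using 1
    · ext i j
      simp [hcat]
    · ext j
      simp
  · intro h
    exact h.submatrix (Equiv.refl _) finSumFinEquiv.symm

/-- Every matrix pair comes from the module presented by `(B, A)`. -/
theorem exists_isPresentation_fromCols {m k n : ℕ} (B : Matrix (Fin m) (Fin k) R)
    (A : Matrix (Fin m) (Fin n) R) :
    ∃ (y : Fin k → Presented (hcat B A)) (x : Fin n → Presented (hcat B A)),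
      IsPresentation (fromCols B A) (Sum.elim y x) := by
  have h := isPresentation_presented (hcat B A)
  let z := fun j => ((hcat B A).vecMulLinear.range.mkQ (Pi.single j 1) : Presented (hcat B A))
  refine ⟨fun j => z (finSumFinEquiv (.inl j)), fun j => z (finSumFinEquiv (.inr j)),
    isPresentation_hcat_iff.1 ?_⟩
  convert h using 1
  ext j
  obtain ⟨j | j, rfl⟩ := finSumFinEquiv.surjective j <;> simp [z]

instance (M : Type u) [AddCommGroup M] [Module R M] [h : Module.FinitePresentation R M] {n : ℕ}
    (x : Fin n → M) : Module.FinitePresentation R (M ⧸ span R (Set.range x)) :=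
  Module.finitePresentation_of_surjective (mkQ _) (mkQ_surjective _)
    (by rw [ker_mkQ]; exact fg_span (Set.finite_range x))

instance (M : Type u) [AddCommGroup M] [Module R M] [h : Module.FinitePresentation R M] (a : M) :
    Module.FinitePresentation R (M ⧸ span R {a}) :=
  Module.finitePresentation_of_surjective (mkQ _) (mkQ_surjective _)
    (by rw [ker_mkQ]; exact fg_span_singleton a)

theorem pointedPair_eq_bot [Module.FinitePresentation R M] {n : ℕ} {x : Fin n → M}
    (hx : ∀ i, x i = 0) : pointedPair M x = (⊥ : MatrixPair R n) := by
  obtain ⟨y, z, h⟩ := exists_isPresentation_fromCols (R := R) (0 : Matrix (Fin n) (Fin 1) R)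
    (1 : Matrix (Fin n) (Fin n) R)
  obtain ⟨m', k', B', A', y', h'⟩ := exists_isPresentation_pair (R := R) x
  have hz (i) : z i = 0 := by
    have := (h.sum_eq_zero_iff (Sum.elim 0 (Pi.single i 1))).2 ⟨Pi.single i 1, by
      ext (j | j) <;> simp [one_apply, Pi.single_apply, eq_comm]⟩
    simpa [Pi.single_apply] using this
  rw [pointedPair_eq_pair h']
  exact Quotient.sound' ⟨(prePair_le_iff h' h).2 ⟨0, by simp [hx]⟩,
    (prePair_le_iff h h').2 ⟨0, by simp [hz]⟩⟩

/-- The four matrix pairs in an exchange relation, described through one module with two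
distinguished tuples `x` and `x'`. -/
theorem exists_exchange_pairs [Module.FinitePresentation R M] {n n' : ℕ} (x : Fin n → M)
    (x' : Fin n' → M) {N N' : Submodule R M} (hN : N = span R (Set.range x))
    (hN' : N' = span R (Set.range x')) :
    ∃ (m k : ℕ) (B : Matrix (Fin m) (Fin k) R) (A : Matrix (Fin m) (Fin n) R)
      (A' : Matrix (Fin m) (Fin n') R),
      pointedPair M x' = pair (hcat B A) A' ∧ pointedPair (M ⧸ N) (N.mkQ ∘ x') = pair B A' ∧
      pointedPair M x = pair (hcat B A') A ∧ pointedPair (M ⧸ N') (N'.mkQ ∘ x) = pair B A := by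
  obtain ⟨m, k, C, y, h⟩ := exists_isPresentation (R := R) (Sum.elim x x')
  let B : Matrix (Fin m) (Fin k) R := C.submatrix id Sum.inl
  let A : Matrix (Fin m) (Fin n) R := C.submatrix id (Sum.inr ∘ Sum.inl)
  let A' : Matrix (Fin m) (Fin n') R := C.submatrix id (Sum.inr ∘ Sum.inr)
  have h1 : IsPresentation (fromCols (fromCols B A) A') (Sum.elim (Sum.elim y x) x') := by
    convert h.submatrix (Equiv.refl _) (Equiv.sumAssoc _ _ _) using 1
    · ext i ((j | j) | j) <;> rfl
    · ext ((j | j) | j) <;> rfl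
  have h2 : IsPresentation (fromCols (fromCols B A') A) (Sum.elim (Sum.elim y x') x) := by
    convert h1.submatrix (Equiv.refl _) ((Equiv.sumAssoc _ _ _).trans
      (((Equiv.refl _).sumCongr (Equiv.sumComm _ _)).trans (Equiv.sumAssoc _ _ _).symm)) using 1
    · ext i ((j | j) | j) <;> rfl
    · ext ((j | j) | j) <;> rfl
  have h3 {a b : ℕ} {D : Matrix (Fin m) (Fin a) R} {E : Matrix (Fin m) (Fin b) R}
      {u : Fin k → M} {v : Fin a → M} {w : Fin b → M}
      (h : IsPresentation (fromCols (fromCols B D) E) (Sum.elim (Sum.elim u v) w)) :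
      IsPresentation (fromCols (hcat B D) E)
        (Sum.elim (Sum.elim u v ∘ finSumFinEquiv.symm) w) := by
    convert h.submatrix (Equiv.refl _) (finSumFinEquiv.symm.sumCongr (Equiv.refl _)) using 1
    · ext i (j | j) <;> rfl
    · ext (j | j) <;> rfl
  refine ⟨m, k, B, A, A', pointedPair_eq_pair (h3 h1), pointedPair_eq_pair (y := N.mkQ ∘ y) ?_,
    pointedPair_eq_pair (h3 h2), pointedPair_eq_pair (y := N'.mkQ ∘ y) ?_⟩
  · rw [← Sum.comp_elim]
    exact h2.quotient hN
  · rw [← Sum.comp_elim]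
    exact h1.quotient hN'

end PointedModules

/-! ### Classes of modules and of pointed modules -/

section Classes

variable {R : Type u} [Ring R] {M M' : Type u} [AddCommGroup M] [Module R M]
  [AddCommGroup M'] [Module R M']

variable (R) in
/-- The class `{M}` of a finitely presented module in `K₀(R-mod, ⊕)`. -/
def splitClass (M : Type u) [AddCommGroup M] [Module R M] [h : Module.FinitePresentation R M] :
    SplitK0 R :=
  QuotientAddGroup.mk (FreeAbelianGroup.of ⟨ModuleCat.of R M, h⟩)

theorem splitClass_eq_add {P : Type u} [AddCommGroup P] [Module R P]
    [Module.FinitePresentation R M] [Module.FinitePresentation R M']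
    [Module.FinitePresentation R P] (e : P ≃ₗ[R] M × M') :
    splitClass R P = splitClass R M + splitClass R M' := by
  refine eq_of_sub_eq_zero ((QuotientAddGroup.eq_zero_iff _).2 (AddSubgroup.subset_closure ?_))
  exact SplitRel.sum ⟨ModuleCat.of R M, ‹_›⟩ ⟨ModuleCat.of R M', ‹_›⟩ ⟨ModuleCat.of R P, ‹_›⟩ e

variable (R M) in
theorem splitClass_eq_zero [Module.FinitePresentation R M] [Subsingleton M] :
    splitClass R M = 0 :=
  left_eq_add.1 (splitClass_eq_add (0 : M ≃ₗ[R] M × M))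

theorem splitClass_congr [Module.FinitePresentation R M] [Module.FinitePresentation R M']
    (e : M ≃ₗ[R] M') : splitClass R M = splitClass R M' := by
  rw [splitClass_eq_add (e.trans (LinearEquiv.prodUnique (R := R) (M₂ := PUnit.{u + 1})).symm),
    splitClass_eq_zero R PUnit, add_zero]

theorem ofMatrix_eq_splitClass [Module.FinitePresentation R M] {m n : ℕ}
    {A : Matrix (Fin m) (Fin n) R} {y : Fin n → M} (h : IsPresentation A y) :
    SplitK0.ofMatrix A = splitClass R M := by
  have := finitePresentation_presented A
  exact splitClass_congr ((isPresentation_presented A).nonempty_equiv h).some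

/-- A form of Schanuel's lemma: if two modules with distinguished tuples map to each other, then
`M ⊕ M' / (x') ≃ M' ⊕ M / (x)`. Both sides are the pushout of `x` and `x'`. -/
theorem nonempty_prod_quotient_equiv {n : ℕ} {x : Fin n → M} {x' : Fin n → M'} (f : M →ₗ[R] M')
    (g : M' →ₗ[R] M) (hf : ∀ i, f (x i) = x' i) (hg : ∀ i, g (x' i) = x i) :
    Nonempty ((M × M' ⧸ span R (Set.range x')) ≃ₗ[R] M' × M ⧸ span R (Set.range x)) := by
  -- The map `(m, [m']) ↦ (f m + m' - f (g m'), [m - g m'])`; exchanging the roles of the two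
  -- modules gives its inverse.
  have aux {M M' : Type u} [AddCommGroup M] [Module R M] [AddCommGroup M'] [Module R M']
      {x : Fin n → M} {x' : Fin n → M'} (f : M →ₗ[R] M') (g : M' →ₗ[R] M)
      (hf : ∀ i, f (x i) = x' i) (hg : ∀ i, g (x' i) = x i) :
      ∃ φ : (M × M' ⧸ span R (Set.range x')) →ₗ[R] M' × M ⧸ span R (Set.range x),
        ∀ m m', φ (m, mkQ _ m') = (f m + (m' - f (g m')), mkQ _ (m - g m')) := by
    have h : span R (Set.range x') ≤ LinearMap.ker
        ((LinearMap.id - f ∘ₗ g).prod (-(mkQ (span R (Set.range x)) ∘ₗ g))) := by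
      rw [span_le]
      rintro _ ⟨i, rfl⟩
      have : x i ∈ span R (Set.range x) := subset_span ⟨i, rfl⟩
      simp [hf, hg, this]
    refine ⟨LinearMap.coprod (f.prod (mkQ _)) (liftQ _ _ h), fun m m' => ?_⟩
    ext <;> simp [sub_eq_add_neg]
  obtain ⟨φ, hφ⟩ := aux f g hf hg
  obtain ⟨ψ, hψ⟩ := aux g f hg hf
  refine ⟨LinearEquiv.ofLinearMap φ ψ (LinearMap.ext ?_) (LinearMap.ext ?_)⟩
  · rintro ⟨m', m⟩
    obtain ⟨m, rfl⟩ := mkQ_surjective _ m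
    rw [LinearMap.comp_apply, hψ, hφ]
    simp only [map_add, map_sub, LinearMap.id_apply]
    congr 1
    · abel
    · abel
  · rintro ⟨m, m'⟩
    obtain ⟨m', rfl⟩ := mkQ_surjective _ m'
    rw [LinearMap.comp_apply, hφ, hψ]
    simp only [map_add, map_sub, LinearMap.id_apply]
    congr 1
    · abel
    · abel

/-- The class in `G₀(R)` of the matrix pair represented by a module with a distinguished
element. -/
noncomputable def zeroClass (M : Type u) [AddCommGroup M] [Module R M] (a : M) :
    GoursatGroupZero R :=
  QuotientAddGroup.mk (FreeAbelianGroup.of (pointedPair M fun _ : Fin 1 => a))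

/-- The class in `G(R)` of the matrix pair represented by a module with a distinguished tuple. -/
noncomputable def tupleClass {n : ℕ} (hn : 0 < n) (M : Type u) [AddCommGroup M] [Module R M]
    (x : Fin n → M) : GoursatGroup R :=
  QuotientAddGroup.mk (gen hn (pointedPair M x))

theorem GoursatGroupZero.mk_eq_zero_of_rel {x : FreeAbelianGroup (MatrixPair R 1)}
    (h : GoursatRelZero R x) : (QuotientAddGroup.mk x : GoursatGroupZero R) = 0 :=
  (QuotientAddGroup.eq_zero_iff _).2 (AddSubgroup.subset_closure h)

theorem GoursatGroup.mk_eq_zero_of_rel {x : FreeAbelianGroup (AnyPair R)} (h : GoursatRel R x) :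
    (QuotientAddGroup.mk x : GoursatGroup R) = 0 :=
  (QuotientAddGroup.eq_zero_iff _).2 (AddSubgroup.subset_closure h)

theorem zeroClass_eq_mk {m k : ℕ} {B : Matrix (Fin m) (Fin k) R} {A : Matrix (Fin m) (Fin 1) R}
    {y : Fin k → M} {a : M} (h : IsPresentation (fromCols B A) (Sum.elim y fun _ => a)) :
    zeroClass M a = GoursatGroupZero.mk B A := by
  rw [zeroClass, pointedPair_eq_pair h, GoursatGroupZero.mk]

section

variable [Module.FinitePresentation R M] [Module.FinitePresentation R M']

theorem zeroClass_congr {a : M} {a' : M'} (f : M →ₗ[R] M') (g : M' →ₗ[R] M) (hf : f a = a')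
    (hg : g a' = a) : (zeroClass M a : GoursatGroupZero R) = zeroClass M' a' := by
  rw [zeroClass, pointedPair_congr f g (fun _ => hf) fun _ => hg, zeroClass]

variable (R M) in
theorem zeroClass_zero : (zeroClass M 0 : GoursatGroupZero R) = 0 := by
  rw [zeroClass, pointedPair_eq_bot fun _ => rfl]
  exact GoursatGroupZero.mk_eq_zero_of_rel .bot

theorem tupleClass_eq_zero {n : ℕ} (hn : 0 < n) {x : Fin n → M} (hx : ∀ i, x i = 0) :
    (tupleClass hn M x : GoursatGroup R) = 0 := by
  rw [tupleClass, pointedPair_eq_bot hx]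
  exact GoursatGroup.mk_eq_zero_of_rel (.bot hn)

variable (R) in
theorem zeroClass_exchange (a b : M) :
    (zeroClass M a : GoursatGroupZero R) + zeroClass (M ⧸ span R {a}) (mkQ _ b) =
      zeroClass M b + zeroClass (M ⧸ span R {b}) (mkQ _ a) := by
  obtain ⟨m, k, B, A, A', h1, h2, h3, h4⟩ := exists_exchange_pairs (R := R)
    (fun _ : Fin 1 => a) (fun _ : Fin 1 => b) (N := span R {a}) (N' := span R {b})
    (by rw [Set.range_const]) (by rw [Set.range_const])
  have h : (GoursatGroupZero.mk (hcat B A) A' - GoursatGroupZero.mk B A') -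
      (GoursatGroupZero.mk (hcat B A') A - GoursatGroupZero.mk B A) = 0 :=
    GoursatGroupZero.mk_eq_zero_of_rel (.exchange A A' B)
  simp only [GoursatGroupZero.mk, ← h1, ← h2, ← h3, ← h4] at h
  rw [sub_eq_zero, sub_eq_sub_iff_add_eq_add] at h
  exact h.symm

variable (R) in
theorem tupleClass_exchange {n n' : ℕ} (hn : 0 < n) (hn' : 0 < n') (x : Fin n → M)
    (x' : Fin n' → M) {N N' : Submodule R M} (hN : N = span R (Set.range x))
    (hN' : N' = span R (Set.range x')) :
    (tupleClass hn M x : GoursatGroup R) + tupleClass hn' (M ⧸ N) (N.mkQ ∘ x') =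
      tupleClass hn' M x' + tupleClass hn (M ⧸ N') (N'.mkQ ∘ x) := by
  obtain ⟨m, k, B, A, A', h1, h2, h3, h4⟩ := exists_exchange_pairs (R := R) x x' hN hN'
  have h : (GoursatGroup.mk hn' (hcat B A) A' - GoursatGroup.mk hn' B A') -
      (GoursatGroup.mk hn (hcat B A') A - GoursatGroup.mk hn B A) = 0 :=
    GoursatGroup.mk_eq_zero_of_rel (.exchange hn hn' A A' B)
  simp only [GoursatGroup.mk, ← h1, ← h2, ← h3, ← h4] at h
  rw [sub_eq_zero, sub_eq_sub_iff_add_eq_add] at h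
  exact h.symm

/-- With `w` a generating tuple, the exchange relation expresses the class of any tuple `x` as a
difference `[M, w] - [M / (x), w]`. -/
theorem tupleClass_add_of_span_eq_top {n n' : ℕ} (hn : 0 < n) (hn' : 0 < n') (x : Fin n → M)
    {w : Fin n' → M} (hw : span R (Set.range w) = ⊤) {N : Submodule R M}
    (hN : N = span R (Set.range x)) :
    (tupleClass hn M x : GoursatGroup R) + tupleClass hn' (M ⧸ N) (N.mkQ ∘ w) =
      tupleClass hn' M w := by
  rw [tupleClass_exchange R hn hn' x w hN rfl, add_eq_left]
  refine tupleClass_eq_zero hn fun i => ?_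
  rw [Function.comp_apply, mkQ_apply, Submodule.Quotient.mk_eq_zero, hw]
  trivial

end

end Classes

/-! ### The morphisms out of the Goursat groups -/

section Morphisms

variable (R : Type u) [Ring R]

/-- The map `ι` from `G₀(R)` to `G(R)`. -/
def goursatInclusion : GoursatGroupZero R →+ GoursatGroup R :=
  QuotientAddGroup.lift _
    (FreeAbelianGroup.lift fun p => QuotientAddGroup.mk (gen one_pos p)) <| by
    rw [AddSubgroup.closure_le]
    rintro _ (⟨A, A', B⟩ | _)
    · have h := GoursatGroup.mk_eq_zero_of_rel (.exchange one_pos one_pos A A' B)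
      simp only [SetLike.mem_coe, AddMonoidHom.mem_ker, map_sub, FreeAbelianGroup.lift_apply_of]
      exact h
    · have h := GoursatGroup.mk_eq_zero_of_rel (.bot (R := R) one_pos)
      simpa only [SetLike.mem_coe, AddMonoidHom.mem_ker, FreeAbelianGroup.lift_apply_of] using h

variable {R}

theorem goursatInclusion_mk {m k : ℕ} (B : Matrix (Fin m) (Fin k) R)
    (A : Matrix (Fin m) (Fin 1) R) :
    goursatInclusion R (GoursatGroupZero.mk B A) = GoursatGroup.mk one_pos B A := by
  simp [goursatInclusion, GoursatGroupZero.mk, GoursatGroup.mk]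

theorem goursatInclusion_zeroClass {M : Type u} [AddCommGroup M] [Module R M] (a : M) :
    goursatInclusion R (zeroClass M a) = tupleClass one_pos M fun _ => a := by
  simp [goursatInclusion, zeroClass, tupleClass]

theorem ofMatrix_sub_ofMatrix {M : Type u} [AddCommGroup M] [Module R M]
    [Module.FinitePresentation R M] {m k n : ℕ} {B : Matrix (Fin m) (Fin k) R}
    {A : Matrix (Fin m) (Fin n) R} {y : Fin k → M} {x : Fin n → M}
    (h : IsPresentation (fromCols B A) (Sum.elim y x)) :
    SplitK0.ofMatrix (hcat B A) - SplitK0.ofMatrix B =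
      splitClass R M - splitClass R (M ⧸ span R (Set.range x)) := by
  rw [ofMatrix_eq_splitClass (isPresentation_hcat_iff.2 h),
    ofMatrix_eq_splitClass (h.quotient rfl)]

/-- The value `{B, A} - {B}` of `γ` on a matrix pair. -/
def pairDifference {n : ℕ} : MatrixPair R n → SplitK0 R :=
  Quotient.lift (fun p => SplitK0.ofMatrix (hcat p.left p.right) - SplitK0.ofMatrix p.left) <| by
    intro p q hpq
    have := finitePresentation_presented (hcat p.left p.right)
    have := finitePresentation_presented (hcat q.left q.right)
    obtain ⟨y, x, h⟩ := exists_isPresentation_fromCols p.left p.right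
    obtain ⟨y', x', h'⟩ := exists_isPresentation_fromCols q.left q.right
    obtain ⟨g, hg⟩ := (prePair_le_iff h h').1 hpq.1
    obtain ⟨f, hf⟩ := (prePair_le_iff h' h).1 hpq.2
    obtain ⟨e⟩ := nonempty_prod_quotient_equiv f g hf hg
    rw [ofMatrix_sub_ofMatrix h, ofMatrix_sub_ofMatrix h', sub_eq_sub_iff_add_eq_add]
    exact (splitClass_eq_add (.refl R _)).symm.trans
      ((splitClass_congr e).trans (splitClass_eq_add (.refl R _)))

theorem pairDifference_pair {m k n : ℕ} (B : Matrix (Fin m) (Fin k) R)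
    (A : Matrix (Fin m) (Fin n) R) :
    pairDifference (pair B A) = SplitK0.ofMatrix (hcat B A) - SplitK0.ofMatrix B :=
  rfl

theorem pairDifference_pointedPair {M : Type u} [AddCommGroup M] [Module R M]
    [Module.FinitePresentation R M] {n : ℕ} (x : Fin n → M) {N : Submodule R M}
    [Module.FinitePresentation R (M ⧸ N)] (hN : N = span R (Set.range x)) :
    pairDifference (pointedPair M x) = splitClass R M - splitClass R (M ⧸ N) := by
  obtain ⟨m, k, B, A, y, h⟩ := exists_isPresentation_pair (R := R) x
  rw [pointedPair_eq_pair h, pairDifference_pair, ofMatrix_sub_ofMatrix h]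
  subst hN
  rfl

theorem isPresentation_blockDiag {M M' : Type u} [AddCommGroup M] [Module R M] [AddCommGroup M']
    [Module R M'] {m k m' k' : ℕ} {B : Matrix (Fin m) (Fin k) R} {B' : Matrix (Fin m') (Fin k') R}
    {y : Fin k → M} {y' : Fin k' → M'} (h : IsPresentation B y) (h' : IsPresentation B' y') :
    IsPresentation (blockDiag B B')
      (Sum.elim (fun j => ((y j, 0) : M × M')) (fun j => (0, y' j)) ∘ finSumFinEquiv.symm) :=
  (h.fromBlocks h').submatrix finSumFinEquiv.symm finSumFinEquiv.symm

theorem ofMatrix_blockDiag {m k m' k' : ℕ} (B : Matrix (Fin m) (Fin k) R)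
    (B' : Matrix (Fin m') (Fin k') R) :
    SplitK0.ofMatrix (blockDiag B B') = SplitK0.ofMatrix B + SplitK0.ofMatrix B' := by
  have := finitePresentation_presented B
  have := finitePresentation_presented B'
  rw [ofMatrix_eq_splitClass (isPresentation_blockDiag (isPresentation_presented B)
    (isPresentation_presented B')), splitClass_eq_add (LinearEquiv.refl R _)]
  rfl

/-- Permuting rows and columns does not change the class of the presented module. -/
theorem ofMatrix_submatrix {m n m' n' : ℕ} (A : Matrix (Fin m) (Fin n) R) (d : Fin m' ≃ Fin m)
    (e : Fin n' ≃ Fin n) : SplitK0.ofMatrix (A.submatrix d e) = SplitK0.ofMatrix A := by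
  have := finitePresentation_presented A
  exact ofMatrix_eq_splitClass ((isPresentation_presented A).submatrix d e)

theorem ofMatrix_hcat_hcat_comm {m k n n' : ℕ} (B : Matrix (Fin m) (Fin k) R)
    (A : Matrix (Fin m) (Fin n) R) (A' : Matrix (Fin m) (Fin n') R) :
    SplitK0.ofMatrix (hcat (hcat B A) A') = SplitK0.ofMatrix (hcat (hcat B A') A) := by
  let e : (Fin k ⊕ Fin n') ⊕ Fin n ≃ (Fin k ⊕ Fin n) ⊕ Fin n' := (Equiv.sumAssoc _ _ _).trans
    (((Equiv.refl _).sumCongr (Equiv.sumComm _ _)).trans (Equiv.sumAssoc _ _ _).symm)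
  let a (i j l : ℕ) : (Fin i ⊕ Fin j) ⊕ Fin l ≃ Fin (i + j + l) :=
    (finSumFinEquiv.sumCongr (Equiv.refl _)).trans finSumFinEquiv
  rw [← ofMatrix_submatrix (hcat (hcat B A) A') (Equiv.refl _)
    ((a k n' n).symm.trans (e.trans (a k n n')))]
  congr 1
  ext i j
  obtain ⟨(j | j) | j, rfl⟩ := (a k n' n).surjective j <;> simp [a, e, hcat]

theorem ofMatrix_hcat_blockDiag {m k n m' k' n' : ℕ} (B : Matrix (Fin m) (Fin k) R)
    (A : Matrix (Fin m) (Fin n) R) (B' : Matrix (Fin m') (Fin k') R)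
    (A' : Matrix (Fin m') (Fin n') R) :
    SplitK0.ofMatrix (hcat (blockDiag B B') (blockDiag A A')) =
      SplitK0.ofMatrix (hcat B A) + SplitK0.ofMatrix (hcat B' A') := by
  let a (i j k l : ℕ) : (Fin i ⊕ Fin j) ⊕ (Fin k ⊕ Fin l) ≃ Fin (i + j + (k + l)) :=
    (finSumFinEquiv.sumCongr finSumFinEquiv).trans finSumFinEquiv
  rw [← ofMatrix_blockDiag, ← ofMatrix_submatrix (blockDiag (hcat B A) (hcat B' A')) (Equiv.refl _)
    ((a k k' n n').symm.trans ((Equiv.sumSumSumComm _ _ _ _).trans (a k n k' n')))]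
  congr 1
  ext i j
  obtain ⟨i | i, rfl⟩ := finSumFinEquiv.surjective i <;>
  obtain ⟨(j | j) | (j | j), rfl⟩ := (a k k' n n').surjective j <;> simp [a, hcat, blockDiag]

variable (R) in
/-- The map `γ` from `G(R)` to `K₀(R-mod, ⊕)`. -/
def goursatToSplitK0 : GoursatGroup R →+ SplitK0 R :=
  QuotientAddGroup.lift _ (FreeAbelianGroup.lift fun p => pairDifference p.2) <| by
    rw [AddSubgroup.closure_le]
    rintro _ (⟨hn, hn', A, A', B⟩ | ⟨hn, hn', B, A, B', A'⟩ | @⟨n, hn⟩)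
    · simp [gen, pairDifference_pair, ofMatrix_hcat_hcat_comm B A A']
      abel
    · simp only [gen, SetLike.mem_coe, AddMonoidHom.mem_ker, map_sub, map_add,
        FreeAbelianGroup.lift_apply_of, pairDifference_pair, ofMatrix_hcat_blockDiag,
        ofMatrix_blockDiag]
      abel
    · rw [← pointedPair_eq_bot (M := PUnit.{u + 1}) (R := R) (x := fun _ : Fin n => 0)
        fun _ => rfl]
      simp [gen, pairDifference_pointedPair _ rfl, splitClass_eq_zero]

theorem goursatToSplitK0_mk {m k n : ℕ} (hn : 0 < n) (B : Matrix (Fin m) (Fin k) R)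
    (A : Matrix (Fin m) (Fin n) R) :
    goursatToSplitK0 R (GoursatGroup.mk hn B A) =
      SplitK0.ofMatrix (hcat B A) - SplitK0.ofMatrix B := by
  simp [goursatToSplitK0, GoursatGroup.mk, gen, pairDifference_pair]

theorem goursatToSplitK0_tupleClass {M : Type u} [AddCommGroup M] [Module R M]
    [Module.FinitePresentation R M] {n : ℕ} (hn : 0 < n) (x : Fin n → M) {N : Submodule R M}
    [Module.FinitePresentation R (M ⧸ N)] (hN : N = span R (Set.range x)) :
    goursatToSplitK0 R (tupleClass hn M x) = splitClass R M - splitClass R (M ⧸ N) := by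
  simp [goursatToSplitK0, tupleClass, gen, pairDifference_pointedPair x hN]

end Morphisms

/-! ### The morphism out of the Grothendieck group -/

section SuccessiveSum

variable {R : Type u} [Ring R] {M M' : Type u} [AddCommGroup M] [Module R M]
  [AddCommGroup M'] [Module R M']

variable (R) in
/-- The sum in `G₀(R)` of the classes `[M / (xᵢ₊₁, …, xₙ), xᵢ]`, obtained by killing the members of
the tuple `x` one at a time, the last one first. -/
noncomputable def successiveSum : ∀ (n : ℕ) (M : Type u) [AddCommGroup M] [Module R M]
    (_ : Fin n → M), GoursatGroupZero R
  | 0, _, _, _, _ => 0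
  | n + 1, M, _, _, x => zeroClass M (x (Fin.last n)) +
      successiveSum n (M ⧸ span R {x (Fin.last n)}) (mkQ _ ∘ x ∘ Fin.castSucc)

theorem successiveSum_succ {n : ℕ} (x : Fin (n + 1) → M) :
    successiveSum R (n + 1) M x = zeroClass M (x (Fin.last n)) +
      successiveSum R n (M ⧸ span R {x (Fin.last n)}) (mkQ _ ∘ x ∘ Fin.castSucc) :=
  rfl

theorem span_range_mkQ_comp {ι : Type*} {x : ι → M} (hx : span R (Set.range x) = ⊤)
    (N : Submodule R M) : span R (Set.range (N.mkQ ∘ x)) = ⊤ := by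
  rw [Set.range_comp, span_image, hx, Submodule.map_top, range_mkQ]

theorem span_range_mkQ_comp_castSucc {n : ℕ} {x : Fin (n + 1) → M}
    (hx : span R (Set.range x) = ⊤) :
    span R (Set.range (mkQ (span R {x (Fin.last n)}) ∘ x ∘ Fin.castSucc)) = ⊤ := by
  rw [eq_top_iff, ← span_range_mkQ_comp hx (span R {x (Fin.last n)}), span_le]
  rintro _ ⟨i, rfl⟩
  induction i using Fin.lastCases with
  | last =>
    have h : mkQ (span R {x (Fin.last n)}) (x (Fin.last n)) = 0 :=
      (Submodule.Quotient.mk_eq_zero _).2 (mem_span_singleton_self _)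
    rw [SetLike.mem_coe, Function.comp_apply, h]
    exact zero_mem _
  | cast i => exact subset_span ⟨i, rfl⟩

theorem subsingleton_of_span_eq_top {x : Fin 0 → M} (hx : span R (Set.range x) = ⊤) :
    Subsingleton M := by
  rw [Set.range_eq_empty, span_empty] at hx
  exact (subsingleton_iff R).1 (subsingleton_iff_bot_eq_top.1 hx)

/-- Elements that correspond under a linear map give a linear map between the quotients. -/
theorem exists_quotient_map (f : M →ₗ[R] M') {a : M} {a' : M'} (h : f a = a') :
    ∃ g : M ⧸ span R {a} →ₗ[R] M' ⧸ span R {a'}, ∀ m, g (mkQ _ m) = mkQ _ (f m) :=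
  ⟨mapQ _ _ f (by simp [h]), fun _ => rfl⟩

variable (R) in
theorem exists_quotient_quotient_map (a b : M) :
    ∃ f : ((M ⧸ span R {a}) ⧸ span R {mkQ (span R {a}) b}) →ₗ[R]
        (M ⧸ span R {b}) ⧸ span R {mkQ (span R {b}) a},
      ∀ m, f (mkQ _ (mkQ _ m)) = mkQ _ (mkQ _ m) := by
  have h1 : span R {a} ≤ LinearMap.ker
      (mkQ (span R {mkQ (span R {b}) a}) ∘ₗ mkQ (span R {b})) := by
    rw [span_singleton_le_iff_mem, LinearMap.mem_ker, LinearMap.comp_apply]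
    exact (Submodule.Quotient.mk_eq_zero _).2 (mem_span_singleton_self _)
  have h2 : span R {mkQ (span R {a}) b} ≤ LinearMap.ker (liftQ _ _ h1) := by
    rw [span_singleton_le_iff_mem, LinearMap.mem_ker]
    have hb : mkQ (span R {b}) b = 0 :=
      (Submodule.Quotient.mk_eq_zero _).2 (mem_span_singleton_self b)
    exact (congrArg (mkQ _) hb).trans (map_zero _)
  exact ⟨liftQ _ _ h2, fun _ => rfl⟩

theorem successiveSum_congr {n : ℕ} {M M' : Type u} [AddCommGroup M] [Module R M]
    [AddCommGroup M'] [Module R M'] [Module.FinitePresentation R M]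
    [Module.FinitePresentation R M'] {x : Fin n → M} {x' : Fin n → M'} (f : M →ₗ[R] M')
    (g : M' →ₗ[R] M) (hf : ∀ i, f (x i) = x' i) (hg : ∀ i, g (x' i) = x i) :
    successiveSum R n M x = successiveSum R n M' x' := by
  induction n generalizing M M' with
  | zero => rfl
  | succ n ih =>
    obtain ⟨f', hf'⟩ := exists_quotient_map f (hf (Fin.last n))
    obtain ⟨g', hg'⟩ := exists_quotient_map g (hg (Fin.last n))
    rw [successiveSum_succ, successiveSum_succ, zeroClass_congr f g (hf _) (hg _),
      ih f' g' (fun i => ?_) fun i => ?_]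
    · simp only [Function.comp_apply, hf', hf]
    · simp only [Function.comp_apply, hg', hg]

theorem successiveSum_eq_zero {n : ℕ} {M : Type u} [AddCommGroup M] [Module R M]
    [Module.FinitePresentation R M] [Subsingleton M] (x : Fin n → M) :
    successiveSum R n M x = 0 := by
  induction n generalizing M with
  | zero => rfl
  | succ n ih =>
    have : Subsingleton (M ⧸ span R {x (Fin.last n)}) := (mkQ_surjective _).subsingleton
    rw [successiveSum_succ, ih, Subsingleton.elim (x (Fin.last n)) 0, zeroClass_zero, zero_add]

/-- Inserting an element at the end of a generating tuple does not change the sum: the exchange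
relation moves the element to the front, where it contributes an element of the zero module. -/
theorem zeroClass_add_successiveSum {n : ℕ} {M : Type u} [AddCommGroup M] [Module R M]
    [Module.FinitePresentation R M] {x : Fin n → M} (hx : span R (Set.range x) = ⊤) (a : M) :
    zeroClass M a + successiveSum R n (M ⧸ span R {a}) (mkQ _ ∘ x) = successiveSum R n M x := by
  induction n generalizing M with
  | zero =>
    have := subsingleton_of_span_eq_top hx
    rw [Subsingleton.elim a 0, zeroClass_zero, zero_add]
    rfl
  | succ n ih =>
    obtain ⟨f, hf⟩ := exists_quotient_quotient_map R a (x (Fin.last n))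
    obtain ⟨g, hg⟩ := exists_quotient_quotient_map R (x (Fin.last n)) a
    rw [successiveSum_succ, successiveSum_succ, ← ih (span_range_mkQ_comp_castSucc hx) (mkQ _ a),
      ← add_assoc, ← add_assoc, Function.comp_apply, zeroClass_exchange]
    congr 1
    exact successiveSum_congr f g (fun _ => hf _) fun _ => hg _

theorem successiveSum_eq_of_span_eq_top {n k : ℕ} {M : Type u} [AddCommGroup M] [Module R M]
    [Module.FinitePresentation R M] {x : Fin n → M} (hx : span R (Set.range x) = ⊤)
    {y : Fin k → M} (hy : span R (Set.range y) = ⊤) :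
    successiveSum R n M x = successiveSum R k M y := by
  induction n generalizing M with
  | zero =>
    have := subsingleton_of_span_eq_top hx
    rw [successiveSum_eq_zero, successiveSum_eq_zero]
  | succ n ih =>
    rw [successiveSum_succ, ih (span_range_mkQ_comp_castSucc hx) (span_range_mkQ_comp hy _),
      zeroClass_add_successiveSum hy]

/-- Additivity of the sum, for a module `P` with retracts `M` and `M'` and a tuple `z` whose last
members come from `M` and whose first members come from `M'`. Asking only for retracts, instead of
a decomposition of `P`, makes the hypotheses stable under killing the last member of `z`. -/
theorem successiveSum_add {n k : ℕ} {P M M' : Type u} [AddCommGroup P] [Module R P]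
    [AddCommGroup M] [Module R M] [AddCommGroup M'] [Module R M'] [Module.FinitePresentation R P]
    [Module.FinitePresentation R M] [Module.FinitePresentation R M'] {z : Fin (k + n) → P}
    {x : Fin n → M} {y : Fin k → M'} (i : M →ₗ[R] P) (p : P →ₗ[R] M) (j : M' →ₗ[R] P)
    (q : P →ₗ[R] M') (hi : ∀ s, i (x s) = z (Fin.natAdd k s))
    (hp : ∀ s, p (z (Fin.natAdd k s)) = x s) (hq' : ∀ s, q (z (Fin.natAdd k s)) = 0)
    (hj : ∀ s, j (y s) = z (Fin.castAdd n s)) (hq : ∀ s, q (z (Fin.castAdd n s)) = y s) :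
    successiveSum R (k + n) P z = successiveSum R n M x + successiveSum R k M' y := by
  induction n generalizing P M with
  | zero => exact (successiveSum_congr q j hq hj).trans (zero_add _).symm
  | succ n ih =>
    have hl : z (Fin.natAdd k (Fin.last n)) = z (Fin.last (k + n)) := rfl
    obtain ⟨i', hi'⟩ := exists_quotient_map i ((hi (Fin.last n)).trans hl)
    obtain ⟨p', hp'⟩ := exists_quotient_map p (hp (Fin.last n))
    have h0 : span R {z (Fin.last (k + n))} ≤ LinearMap.ker q := by
      rw [span_singleton_le_iff_mem, LinearMap.mem_ker, ← hl, hq']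
    have h := ih (z := mkQ (span R {z (Fin.last (k + n))}) ∘ z ∘ Fin.castSucc)
      (x := mkQ (span R {x (Fin.last n)}) ∘ x ∘ Fin.castSucc) i' p' (mkQ _ ∘ₗ j) (liftQ _ q h0)
      (fun s => by simp only [Function.comp_apply, hi', hi]; rfl)
      (fun s => (hp' _).trans (congrArg _ (hp s.castSucc))) (fun s => hq' s.castSucc)
      (fun s => congrArg (mkQ _) (hj s)) (fun s => hq s)
    have h1 : zeroClass P (z (Fin.last (k + n))) =
        (zeroClass M (x (Fin.last n)) : GoursatGroupZero R) :=
      zeroClass_congr p i (hp (Fin.last n)) (hi (Fin.last n))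
    refine (successiveSum_succ (n := k + n) z).trans ?_
    rw [successiveSum_succ, h, h1, add_assoc]

/-- For the module presented by `A` with its standard generators, the sum is the formula that
defines `κ`. -/
theorem successiveSum_eq_sum_colsBefore {m n : ℕ} {M : Type u} [AddCommGroup M] [Module R M]
    {A : Matrix (Fin m) (Fin n) R} {x : Fin n → M} (h : IsPresentation A x) :
    successiveSum R n M x = ∑ i, GoursatGroupZero.mk (colsBefore A i) (column A i) := by
  induction n generalizing M with
  | zero => rfl
  | succ n ih =>
    have hA : fromCols (colsBefore A (Fin.last n) : Matrix (Fin m) (Fin n) R)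
        (column A (Fin.last n)) = A.submatrix (Equiv.refl _) (finSumFinEquiv (m := n) (n := 1)) := by
      ext i (j | j)
      · rfl
      · rw [Subsingleton.elim j 0]
        rfl
    have hy : Sum.elim (x ∘ Fin.castSucc) (fun _ : Fin 1 => x (Fin.last n)) =
        x ∘ finSumFinEquiv (m := n) (n := 1) := by
      ext (j | j)
      · rfl
      · rw [Subsingleton.elim j 0]
        rfl
    have h1 : IsPresentation (fromCols (colsBefore A (Fin.last n) : Matrix (Fin m) (Fin n) R)
        (column A (Fin.last n))) (Sum.elim (x ∘ Fin.castSucc) fun _ => x (Fin.last n)) := by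
      rw [hA, hy]
      exact h.submatrix _ _
    have h2 := h1.quotient (N := span R {x (Fin.last n)}) (by rw [Set.range_const])
    rw [successiveSum_succ, Fin.sum_univ_castSucc, add_comm, zeroClass_eq_mk h1, ih h2]
    rfl

variable (R) in
/-- The value of `κ` on a finitely presented module: the sum for any generating tuple. -/
noncomputable def moduleSum (M : Type u) [AddCommGroup M] [Module R M]
    [Module.FinitePresentation R M] : GoursatGroupZero R :=
  successiveSum R _ M (Module.Finite.exists_fin (R := R) (M := M)).choose_spec.choose

theorem moduleSum_eq [Module.FinitePresentation R M] {n : ℕ} {x : Fin n → M}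
    (hx : span R (Set.range x) = ⊤) : moduleSum R M = successiveSum R n M x :=
  successiveSum_eq_of_span_eq_top
    (Module.Finite.exists_fin (R := R) (M := M)).choose_spec.choose_spec hx

theorem moduleSum_eq_add {P : Type u} [AddCommGroup P] [Module R P]
    [Module.FinitePresentation R M] [Module.FinitePresentation R M']
    [Module.FinitePresentation R P] (e : P ≃ₗ[R] M × M') :
    moduleSum R P = moduleSum R M + moduleSum R M' := by
  obtain ⟨n, x, hx⟩ := Module.Finite.exists_fin (R := R) (M := M)
  obtain ⟨k, y, hy⟩ := Module.Finite.exists_fin (R := R) (M := M')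
  let z : Fin (k + n) → P := Fin.append (fun s => e.symm (0, y s)) fun s => e.symm (x s, 0)
  have hz : span R (Set.range z) = ⊤ := by
    have h1 : span R (Set.range x) ≤ (span R (Set.range z)).comap
        (e.symm.toLinearMap ∘ₗ LinearMap.inl R M M') := by
      rw [span_le]
      rintro _ ⟨s, rfl⟩
      exact subset_span ⟨Fin.natAdd k s, by simp [z]⟩
    have h2 : span R (Set.range y) ≤ (span R (Set.range z)).comap
        (e.symm.toLinearMap ∘ₗ LinearMap.inr R M M') := by
      rw [span_le]
      rintro _ ⟨s, rfl⟩
      exact subset_span ⟨Fin.castAdd n s, by simp [z]⟩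
    rw [eq_top_iff]
    rintro a -
    have h3 := (span R (Set.range z)).add_mem (h1 (hx.ge (mem_top : (e a).1 ∈ (⊤ : Submodule R M))))
      (h2 (hy.ge (mem_top : (e a).2 ∈ (⊤ : Submodule R M'))))
    have h4 : e.symm ((e a).1, 0) + e.symm (0, (e a).2) = a := by
      rw [← map_add, Prod.mk_add_mk, add_zero, zero_add, Prod.mk.eta, e.symm_apply_apply]
    exact h4 ▸ h3
  rw [moduleSum_eq hx, moduleSum_eq hy, moduleSum_eq hz]
  apply successiveSum_add (e.symm.toLinearMap ∘ₗ LinearMap.inl R M M')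
    (LinearMap.fst R M M' ∘ₗ e.toLinearMap) (e.symm.toLinearMap ∘ₗ LinearMap.inr R M M')
    (LinearMap.snd R M M' ∘ₗ e.toLinearMap) <;> simp [z]

variable (R) in
/-- The map `κ` from `K₀(R-mod, ⊕)` to `G₀(R)`. -/
noncomputable def splitK0ToGoursat : SplitK0 R →+ GoursatGroupZero R :=
  QuotientAddGroup.lift _
    (FreeAbelianGroup.lift fun P : FPModule R => have := P.2; moduleSum R P.1) <| by
    rw [AddSubgroup.closure_le]
    rintro _ ⟨M, N, P, e⟩
    have := M.2
    have := N.2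
    have := P.2
    simp [moduleSum_eq_add e]

theorem splitK0ToGoursat_splitClass [Module.FinitePresentation R M] :
    splitK0ToGoursat R (splitClass R M) = moduleSum R M := by
  simp [splitK0ToGoursat, splitClass]

theorem splitK0ToGoursat_ofMatrix {m n : ℕ} (A : Matrix (Fin m) (Fin n) R) :
    splitK0ToGoursat R (SplitK0.ofMatrix A) =
      ∑ i, GoursatGroupZero.mk (colsBefore A i) (column A i) := by
  have := finitePresentation_presented A
  have h := isPresentation_presented A
  rw [← successiveSum_eq_sum_colsBefore h, ← moduleSum_eq h.span_eq_top,
    ← splitK0ToGoursat_splitClass]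
  rfl

end SuccessiveSum

/-! ### The triangle -/

section Triangle

variable {R : Type u} [Ring R]

theorem exists_pointedPair_eq {n : ℕ} (p : MatrixPair R n) :
    ∃ (M : Type u) (_ : AddCommGroup M) (_ : Module R M) (_ : Module.FinitePresentation R M)
      (x : Fin n → M), pointedPair M x = p := by
  obtain ⟨⟨m, k, B, A⟩⟩ := p
  obtain ⟨y, x, h⟩ := exists_isPresentation_fromCols B A
  exact ⟨_, _, _, finitePresentation_presented (hcat B A), x, pointedPair_eq_pair h⟩

/-- The sum defining `γ ι κ {M}` telescopes to `{M} - {0}`. -/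
theorem goursatToSplitK0_goursatInclusion_successiveSum {n : ℕ} {M : Type u} [AddCommGroup M]
    [Module R M] [Module.FinitePresentation R M] {x : Fin n → M}
    (hx : span R (Set.range x) = ⊤) :
    goursatToSplitK0 R (goursatInclusion R (successiveSum R n M x)) = splitClass R M := by
  induction n generalizing M with
  | zero =>
    have := subsingleton_of_span_eq_top hx
    rw [splitClass_eq_zero, successiveSum_eq_zero, map_zero, map_zero]
  | succ n ih =>
    rw [successiveSum_succ, map_add, map_add, ih (span_range_mkQ_comp_castSucc hx),
      goursatInclusion_zeroClass,
      goursatToSplitK0_tupleClass one_pos _ (N := span R {x (Fin.last n)})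
        (by rw [Set.range_const]), sub_add_cancel]

/-- The sum defining `ι κ {M}` telescopes to the class of `M` with any generating tuple. -/
theorem goursatInclusion_successiveSum {n k : ℕ} (hk : 0 < k) {M : Type u} [AddCommGroup M]
    [Module R M] [Module.FinitePresentation R M] {x : Fin n → M}
    (hx : span R (Set.range x) = ⊤) {w : Fin k → M} (hw : span R (Set.range w) = ⊤) :
    goursatInclusion R (successiveSum R n M x) = tupleClass hk M w := by
  induction n generalizing M with
  | zero =>
    have := subsingleton_of_span_eq_top hx
    rw [successiveSum_eq_zero, map_zero, tupleClass_eq_zero hk fun _ => Subsingleton.elim _ _]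
  | succ n ih =>
    rw [successiveSum_succ, map_add, goursatInclusion_zeroClass,
      ih (span_range_mkQ_comp_castSucc hx) (span_range_mkQ_comp hw _),
      tupleClass_add_of_span_eq_top one_pos hk _ hw (by rw [Set.range_const])]

theorem exists_pos_span_eq_top (M : Type u) [AddCommGroup M] [Module R M] [Module.Finite R M] :
    ∃ (n : ℕ) (x : Fin (n + 1) → M), span R (Set.range x) = ⊤ := by
  obtain ⟨n, x, hx⟩ := Module.Finite.exists_fin (R := R) (M := M)
  refine ⟨n, Fin.cons 0 x, ?_⟩
  rw [eq_top_iff, ← hx, Fin.range_cons]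
  exact span_mono (Set.subset_insert _ _)

theorem goursatInclusion_moduleSum {k : ℕ} (hk : 0 < k) {M : Type u} [AddCommGroup M]
    [Module R M] [Module.FinitePresentation R M] {w : Fin k → M}
    (hw : span R (Set.range w) = ⊤) :
    goursatInclusion R (moduleSum R M) = tupleClass hk M w := by
  rw [moduleSum_eq hw, goursatInclusion_successiveSum hk hw hw]

variable (R)

theorem triangle_goursatGroupZero :
    ((splitK0ToGoursat R).comp (goursatToSplitK0 R)).comp (goursatInclusion R) =
      AddMonoidHom.id (GoursatGroupZero R) := by
  refine QuotientAddGroup.addMonoidHom_ext _ (FreeAbelianGroup.lift_ext _ _ fun p => ?_)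
  obtain ⟨M, _, _, _, x, rfl⟩ := exists_pointedPair_eq p
  obtain ⟨a, rfl⟩ : ∃ a, x = fun _ => a := ⟨x 0, funext fun i => by rw [Subsingleton.elim i 0]⟩
  change splitK0ToGoursat R (goursatToSplitK0 R (goursatInclusion R (zeroClass M a))) =
    zeroClass M a
  obtain ⟨n, w, hw⟩ := Module.Finite.exists_fin (R := R) (M := M)
  rw [goursatInclusion_zeroClass, goursatToSplitK0_tupleClass one_pos _ (N := span R {a})
    (by rw [Set.range_const]), map_sub, splitK0ToGoursat_splitClass, splitK0ToGoursat_splitClass,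
    moduleSum_eq hw, moduleSum_eq (span_range_mkQ_comp hw _), ← zeroClass_add_successiveSum hw a,
    add_sub_cancel_right]

theorem triangle_goursatGroup :
    ((goursatInclusion R).comp (splitK0ToGoursat R)).comp (goursatToSplitK0 R) =
      AddMonoidHom.id (GoursatGroup R) := by
  refine QuotientAddGroup.addMonoidHom_ext _ (FreeAbelianGroup.lift_ext _ _ fun p => ?_)
  obtain ⟨⟨n, hn⟩, p⟩ := p
  obtain ⟨M, _, _, _, x, rfl⟩ := exists_pointedPair_eq p
  change goursatInclusion R (splitK0ToGoursat R (goursatToSplitK0 R (tupleClass hn M x))) =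
    tupleClass hn M x
  obtain ⟨k, w, hw⟩ := exists_pos_span_eq_top (R := R) M
  rw [goursatToSplitK0_tupleClass hn x rfl, map_sub, map_sub, splitK0ToGoursat_splitClass,
    splitK0ToGoursat_splitClass, goursatInclusion_moduleSum k.succ_pos hw,
    goursatInclusion_moduleSum k.succ_pos (span_range_mkQ_comp hw _),
    ← tupleClass_add_of_span_eq_top hn k.succ_pos x hw rfl, add_sub_cancel_right]

theorem triangle_splitK0 :
    ((goursatToSplitK0 R).comp (goursatInclusion R)).comp (splitK0ToGoursat R) =
      AddMonoidHom.id (SplitK0 R) := by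
  refine QuotientAddGroup.addMonoidHom_ext _ (FreeAbelianGroup.lift_ext _ _ fun P => ?_)
  have := P.2
  change goursatToSplitK0 R (goursatInclusion R (splitK0ToGoursat R (splitClass R P.1))) =
    splitClass R P.1
  obtain ⟨n, w, hw⟩ := Module.Finite.exists_fin (R := R) (M := P.1)
  rw [splitK0ToGoursat_splitClass, moduleSum_eq hw,
    goursatToSplitK0_goursatInclusion_successiveSum hw]

/-- A map in a triangle is bijective if the round trips from its two ends are the identity. -/
theorem bijective_of_triangle {α : Type*} {β : Type*} {δ : Type*} {f : α → β} {g : β → δ}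
    {h : δ → α} (h1 : ∀ a, h (g (f a)) = a) (h2 : ∀ b, f (h (g b)) = b) : f.Bijective :=
  ⟨Function.LeftInverse.injective (g := h ∘ g) h1, fun b => ⟨h (g b), h2 b⟩⟩

end Triangle

/-! ### Naturality in the ring -/

section Naturality

variable {R S : Type u} [Ring R] [Ring S] (f : R →+* S)

theorem hcat_map {m k n : ℕ} (B : Matrix (Fin m) (Fin k) R) (A : Matrix (Fin m) (Fin n) R) :
    (hcat B A).map f = hcat (B.map f) (A.map f) := by
  ext i j
  obtain ⟨j | j, rfl⟩ := finSumFinEquiv.surjective j <;> simp [hcat]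

theorem blockDiag_map {m n m' n' : ℕ} (A : Matrix (Fin m) (Fin n) R)
    (B : Matrix (Fin m') (Fin n') R) :
    (blockDiag A B).map f = blockDiag (A.map f) (B.map f) := by
  ext i j
  obtain ⟨i | i, rfl⟩ := finSumFinEquiv.surjective i <;>
  obtain ⟨j | j, rfl⟩ := finSumFinEquiv.surjective j <;> simp [blockDiag]

theorem prePair_map_le {n : ℕ} {p q : PrePair R n} (h : p ≤ q) :
    (⟨p.rows, p.cols, p.left.map f, p.right.map f⟩ : PrePair S n) ≤
      ⟨q.rows, q.cols, q.left.map f, q.right.map f⟩ := by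
  obtain ⟨U, V, G, h1, h2⟩ := h
  refine ⟨U.map f, V.map f, G.map f, ?_, ?_⟩
  · rw [← Matrix.map_mul, h1, Matrix.map_mul]
  · rw [← Matrix.map_mul, h2, Matrix.map_add _ (map_add f), Matrix.map_mul]

/-- The map on matrix pairs induced by a ring morphism. -/
def pairMap {n : ℕ} : MatrixPair R n → MatrixPair S n :=
  Quotient.map (fun p => ⟨p.rows, p.cols, p.left.map f, p.right.map f⟩)
    fun _ _ h => ⟨prePair_map_le f h.1, prePair_map_le f h.2⟩

theorem pairMap_pair {m k n : ℕ} (B : Matrix (Fin m) (Fin k) R) (A : Matrix (Fin m) (Fin n) R) :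
    pairMap f (pair B A) = pair (B.map f) (A.map f) :=
  rfl

theorem pairMap_bot {n : ℕ} : pairMap f (⊥ : MatrixPair R n) = ⊥ := by
  change pairMap f (pair 0 1) = pair 0 1
  rw [pairMap_pair, Matrix.map_zero _ (map_zero f), Matrix.map_one _ (map_zero f) (map_one f)]

/-- The morphism `G₀(f)`. -/
def goursatZeroMap : GoursatGroupZero R →+ GoursatGroupZero S :=
  QuotientAddGroup.lift _
    (FreeAbelianGroup.lift fun p => QuotientAddGroup.mk (FreeAbelianGroup.of (pairMap f p))) <| by
    rw [AddSubgroup.closure_le]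
    rintro _ (⟨A, A', B⟩ | _)
    · simp only [SetLike.mem_coe, AddMonoidHom.mem_ker, map_sub, FreeAbelianGroup.lift_apply_of,
        pairMap_pair, hcat_map]
      exact GoursatGroupZero.mk_eq_zero_of_rel (.exchange (A.map f) (A'.map f) (B.map f))
    · simp only [SetLike.mem_coe, AddMonoidHom.mem_ker, FreeAbelianGroup.lift_apply_of,
        pairMap_bot]
      exact GoursatGroupZero.mk_eq_zero_of_rel .bot

theorem goursatZeroMap_mk {m k : ℕ} (B : Matrix (Fin m) (Fin k) R)
    (A : Matrix (Fin m) (Fin 1) R) :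
    goursatZeroMap f (GoursatGroupZero.mk B A) = GoursatGroupZero.mk (B.map f) (A.map f) := by
  simp [goursatZeroMap, GoursatGroupZero.mk, pairMap_pair]

/-- The morphism `G(f)`. -/
def goursatMap : GoursatGroup R →+ GoursatGroup S :=
  QuotientAddGroup.lift _
    (FreeAbelianGroup.lift fun p => QuotientAddGroup.mk (gen p.1.2 (pairMap f p.2))) <| by
    rw [AddSubgroup.closure_le]
    rintro _ (⟨hn, hn', A, A', B⟩ | ⟨hn, hn', B, A, B', A'⟩ | hn)
    · simp only [SetLike.mem_coe, AddMonoidHom.mem_ker, map_sub, gen,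
        FreeAbelianGroup.lift_apply_of, pairMap_pair, hcat_map]
      exact GoursatGroup.mk_eq_zero_of_rel (.exchange hn hn' (A.map f) (A'.map f) (B.map f))
    · simp only [SetLike.mem_coe, AddMonoidHom.mem_ker, map_sub, map_add, gen,
        FreeAbelianGroup.lift_apply_of, pairMap_pair, blockDiag_map]
      exact GoursatGroup.mk_eq_zero_of_rel
        (.sum hn hn' (B.map f) (A.map f) (B'.map f) (A'.map f))
    · simp only [SetLike.mem_coe, AddMonoidHom.mem_ker, gen, FreeAbelianGroup.lift_apply_of,
        pairMap_bot]
      exact GoursatGroup.mk_eq_zero_of_rel (.bot hn)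

theorem goursatMap_mk {m k n : ℕ} (hn : 0 < n) (B : Matrix (Fin m) (Fin k) R)
    (A : Matrix (Fin m) (Fin n) R) :
    goursatMap f (GoursatGroup.mk hn B A) = GoursatGroup.mk hn (B.map f) (A.map f) := by
  simp [goursatMap, GoursatGroup.mk, gen, pairMap_pair]

theorem goursatMap_comp_goursatInclusion :
    (goursatMap f).comp (goursatInclusion R) = (goursatInclusion S).comp (goursatZeroMap f) := by
  refine QuotientAddGroup.addMonoidHom_ext _ (FreeAbelianGroup.lift_ext _ _ fun p => ?_)
  obtain ⟨p⟩ := p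
  change goursatMap f (goursatInclusion R (GoursatGroupZero.mk p.left p.right)) =
    goursatInclusion S (goursatZeroMap f (GoursatGroupZero.mk p.left p.right))
  rw [goursatInclusion_mk, goursatMap_mk, goursatZeroMap_mk, goursatInclusion_mk]

/-- The morphism `K₀(f)`, defined by transporting `G₀(f)` along the triangle. This avoids extension
of scalars for modules over noncommutative rings; `splitK0Map_ofMatrix` shows that it applies `f` to
the entries of a presentation. -/
noncomputable def splitK0Map : SplitK0 R →+ SplitK0 S :=
  ((goursatToSplitK0 S).comp (goursatInclusion S)).comp
    ((goursatZeroMap f).comp (splitK0ToGoursat R))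

theorem splitK0Map_ofMatrix {m n : ℕ} (A : Matrix (Fin m) (Fin n) R) :
    splitK0Map f (SplitK0.ofMatrix A) = SplitK0.ofMatrix (A.map f) := by
  have h : goursatZeroMap f (splitK0ToGoursat R (SplitK0.ofMatrix A)) =
      splitK0ToGoursat S (SplitK0.ofMatrix (A.map f)) := by
    rw [splitK0ToGoursat_ofMatrix, splitK0ToGoursat_ofMatrix, map_sum]
    exact Finset.sum_congr rfl fun i _ => goursatZeroMap_mk f _ _
  change goursatToSplitK0 S (goursatInclusion S (goursatZeroMap f _)) = _
  rw [h]
  exact DFunLike.congr_fun (triangle_splitK0 S) _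

theorem splitK0Map_comp_goursatToSplitK0 :
    (splitK0Map f).comp (goursatToSplitK0 R) = (goursatToSplitK0 S).comp (goursatMap f) := by
  refine AddMonoidHom.ext fun x => ?_
  have h1 := DFunLike.congr_fun (goursatMap_comp_goursatInclusion f)
    (splitK0ToGoursat R (goursatToSplitK0 R x))
  have h2 : goursatInclusion R (splitK0ToGoursat R (goursatToSplitK0 R x)) = x :=
    DFunLike.congr_fun (triangle_goursatGroup R) x
  simp only [AddMonoidHom.comp_apply, h2] at h1
  simp only [splitK0Map, AddMonoidHom.comp_apply, ← h1]

theorem goursatZeroMap_comp_splitK0ToGoursat :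
    (goursatZeroMap f).comp (splitK0ToGoursat R) = (splitK0ToGoursat S).comp (splitK0Map f) := by
  refine AddMonoidHom.ext fun x => ?_
  exact (DFunLike.congr_fun (triangle_goursatGroupZero S)
    (goursatZeroMap f (splitK0ToGoursat R x))).symm

end Naturality

end MatrixCalculus

theorem mainTheorem1 :
    ∃ (ι : ∀ (R : Type u) [Ring R],
          MatrixCalculus.GoursatGroupZero R →+ MatrixCalculus.GoursatGroup R)
      (γ : ∀ (R : Type u) [Ring R],
          MatrixCalculus.GoursatGroup R →+ MatrixCalculus.SplitK0 R)
      (κ : ∀ (R : Type u) [Ring R],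
          MatrixCalculus.SplitK0 R →+ MatrixCalculus.GoursatGroupZero R),
      (∀ (R : Type u) [Ring R],
        -- the values on generators
        (∀ (m k : ℕ) (B : Matrix (Fin m) (Fin k) R) (A : Matrix (Fin m) (Fin 1) R),
          ι R (MatrixCalculus.GoursatGroupZero.mk B A) =
            MatrixCalculus.GoursatGroup.mk one_pos B A) ∧
        (∀ (m k n : ℕ) (hn : 0 < n) (B : Matrix (Fin m) (Fin k) R)
            (A : Matrix (Fin m) (Fin n) R),
          γ R (MatrixCalculus.GoursatGroup.mk hn B A) =
            MatrixCalculus.SplitK0.ofMatrix (MatrixCalculus.hcat B A) -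
              MatrixCalculus.SplitK0.ofMatrix B) ∧
        (∀ (m n : ℕ) (A : Matrix (Fin m) (Fin n) R),
          κ R (MatrixCalculus.SplitK0.ofMatrix A) =
            ∑ i : Fin n, MatrixCalculus.GoursatGroupZero.mk
              (MatrixCalculus.colsBefore A i) (MatrixCalculus.column A i)) ∧
        -- all three are isomorphisms
        Function.Bijective (ι R) ∧ Function.Bijective (γ R) ∧ Function.Bijective (κ R) ∧
        -- going once around the triangle is the identity, from each vertex
        ((κ R).comp (γ R)).comp (ι R) =
          AddMonoidHom.id (MatrixCalculus.GoursatGroupZero R) ∧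
        ((ι R).comp (κ R)).comp (γ R) = AddMonoidHom.id (MatrixCalculus.GoursatGroup R) ∧
        ((γ R).comp (ι R)).comp (κ R) = AddMonoidHom.id (MatrixCalculus.SplitK0 R)) ∧
      -- naturality in the ring
      (∀ (R S : Type u) [Ring R] [Ring S] (f : R →+* S),
        ∃ (G₀f : MatrixCalculus.GoursatGroupZero R →+ MatrixCalculus.GoursatGroupZero S)
          (Gf : MatrixCalculus.GoursatGroup R →+ MatrixCalculus.GoursatGroup S)
          (K₀f : MatrixCalculus.SplitK0 R →+ MatrixCalculus.SplitK0 S),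
          (∀ (m k : ℕ) (B : Matrix (Fin m) (Fin k) R) (A : Matrix (Fin m) (Fin 1) R),
            G₀f (MatrixCalculus.GoursatGroupZero.mk B A) =
              MatrixCalculus.GoursatGroupZero.mk (B.map f) (A.map f)) ∧
          (∀ (m k n : ℕ) (hn : 0 < n) (B : Matrix (Fin m) (Fin k) R)
              (A : Matrix (Fin m) (Fin n) R),
            Gf (MatrixCalculus.GoursatGroup.mk hn B A) =
              MatrixCalculus.GoursatGroup.mk hn (B.map f) (A.map f)) ∧
          (∀ (m n : ℕ) (A : Matrix (Fin m) (Fin n) R),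
            K₀f (MatrixCalculus.SplitK0.ofMatrix A) =
              MatrixCalculus.SplitK0.ofMatrix (A.map f)) ∧
          Gf.comp (ι R) = (ι S).comp G₀f ∧
          K₀f.comp (γ R) = (γ S).comp Gf ∧
          G₀f.comp (κ R) = (κ S).comp K₀f) := by
  open MatrixCalculus in
  refine ⟨goursatInclusion, goursatToSplitK0, splitK0ToGoursat, ?_, ?_⟩
  · intro R _
    have h0 := DFunLike.congr_fun (triangle_goursatGroupZero R)
    have h1 := DFunLike.congr_fun (triangle_goursatGroup R)
    have h2 := DFunLike.congr_fun (triangle_splitK0 R)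
    exact ⟨fun _ _ => goursatInclusion_mk, fun _ _ _ => goursatToSplitK0_mk,
      fun _ _ => splitK0ToGoursat_ofMatrix, bijective_of_triangle h0 h1,
      bijective_of_triangle h1 h2, bijective_of_triangle h2 h0, triangle_goursatGroupZero R,
      triangle_goursatGroup R, triangle_splitK0 R⟩
  · intro R S _ _ f
    exact ⟨goursatZeroMap f, goursatMap f, splitK0Map f, fun _ _ => goursatZeroMap_mk f,
      fun _ _ _ => goursatMap_mk f, fun _ _ => splitK0Map_ofMatrix f,
      goursatMap_comp_goursatInclusion f, splitK0Map_comp_goursatToSplitK0 f,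
      goursatZeroMap_comp_splitK0ToGoursat f⟩
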